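/- Let $\zeta$ be the Riemann zeta function and let $(b_n)_{n\ge 0}$ be the Lehmer constants, i.e. the Taylor coefficients at $s=0$ of $\frac{d}{ds}\log[2(s-1)\zeta(s)]$. These are real numbers and $$\frac{\zeta'(s)}{\zeta(s)}+\frac{1}{s-1}=\sum_{n=0}^{\infty} b_n s^n ,\qquad |s|<2$$ (the singularity of the left-hand side at $s=1$ being removable). Then for every integer $n\ge 1$ $$\zeta(n+1)-1-\bigl[1+(-1)^{n+1}\bigr]\frac{\zeta(n+1)}{2^{n+1}}>b_n .$$ In particular, for every integer $n\ge 1$, $$b_{2n}<\zeta(2n+1)-1<1 .$$ -/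

import Mathlib

/-- The Lehmer constants `b n`: the coefficients of the Taylor expansion about `s = 0` of
`d/ds log (2 (s - 1) ζ(s)) = ζ'(s) / ζ(s) + 1 / (s - 1)`. The coefficients are real, so the
real part only serves to obtain a real number. -/
noncomputable def lehmerB (n : ℕ) : ℝ :=
  (iteratedDeriv n (fun s : ℂ => deriv riemannZeta s / riemannZeta s + 1 / (s - 1)) 0
    / (n.factorial : ℂ)).re

/-- The real value `ζ(k)` of the Riemann zeta function at a natural number `k`. -/
noncomputable def zetaNat (k : ℕ) : ℝ := (riemannZeta (k : ℂ)).re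

/-! Put `1 + xiAux s = s (s - 1) Λ(s)`, which is twice Riemann's ξ. From `(s - 1) ζ(s) π^(-s/2)
Γ(s/2 + 1) = (1 + xiAux s) / 2`, logarithmic differentiation splits the Lehmer series into the ξ
part, with coefficients `c n`, and the part `log π / 2 - ψ(s/2 + 1) / 2`. The Taylor series of the
digamma function ψ at 1 gives `b_{k-1} = Re c_{k-1} - (-1)^k ζ(k) / 2^k` for `k ≥ 2`. The claim thus
becomes `Re c_{k-1} < ζ(k) (1 - 2^(-k)) - 1`. The right side is the sum of `j^(-k)` over odd `j ≥
3`, so it is at least `3^(-k) + 5^(-k)`. The left side is small because ξ has no zeros near 0.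
Explicit theta-integral bounds show that `1 + xiAux` does not vanish on the disc of radius 5.1 and
has modulus at most 2.245 on `|s| = 5`. Borel–Carathéodory for its logarithm then gives `|c_{k-1}| ≤
1.8 k / 5^k`, and `1.8 k < (5/3)^k + 1` finishes the proof. The carrying lemmas are
`exists_hasSum_logDeriv_one_add_xiAux`, `Real.hasSum_deriv_log_Gamma`, `exists_lehmerB_eq` and
`one_add_le_zetaNat_mul_one_sub`. -/

theorem exp_neg_pi_le : Real.exp (-Real.pi) ≤ 1 / 23 := by
  have h1 : Real.exp 3.14 ≤ Real.exp Real.pi := Real.exp_le_exp.2 Real.pi_gt_d2.le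
  have h2 : (20.08 : ℝ) ≤ Real.exp 3 := by
    have := Real.exp_one_gt_d9
    have h3 : Real.exp 3 = Real.exp 1 ^ 3 := by rw [← Real.exp_nat_mul]; norm_num
    rw [h3]
    calc (20.08 : ℝ) ≤ 2.7182818283 ^ 3 := by norm_num
      _ ≤ _ := by gcongr
  have h3 : (1.1498 : ℝ) ≤ Real.exp 0.14 := by
    have := Real.quadratic_le_exp_of_nonneg (x := 0.14) (by norm_num)
    norm_num at this ⊢; linarith
  have h4 : Real.exp 3.14 = Real.exp 3 * Real.exp 0.14 := by rw [← Real.exp_add]; norm_num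
  have h5 : (23 : ℝ) ≤ Real.exp Real.pi := by nlinarith
  rw [Real.exp_neg, one_div]
  exact inv_anti₀ (by norm_num) h5

/-! ### Theta-integral bounds for the completed zeta function -/

namespace HurwitzZeta
open Set MeasureTheory Filter Topology

theorem evenKernel_zero_sub_one_nonneg {x : ℝ} (hx : 0 < x) : 0 ≤ evenKernel 0 x - 1 := by
  have h := hasSum_nat_cosKernel₀ 0 hx
  rw [evenKernel_eq_cosKernel_of_zero]
  refine h.nonneg fun n => ?_
  simp only [mul_zero, zero_mul, Real.cos_zero]
  positivity

theorem evenKernel_zero_sub_one_le {x : ℝ} (hx : 1 ≤ x) :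
    evenKernel 0 x - 1 ≤ 2.1 * Real.exp (-Real.pi * x) := by
  have h := hasSum_nat_cosKernel₀ 0 (zero_lt_one.trans_le hx)
  rw [evenKernel_eq_cosKernel_of_zero]
  set r := Real.exp (-Real.pi * x) with hr
  have hr0 : 0 < r := Real.exp_pos _
  have hr1 : r ≤ 1 / 23 := by
    refine le_trans (Real.exp_le_exp.2 ?_) exp_neg_pi_le
    nlinarith [Real.pi_pos]
  have hg := ((hasSum_geometric_of_lt_one hr0.le (by linarith)).mul_left (2 * r))
  have hle : cosKernel 0 x - 1 ≤ 2 * r * (1 - r)⁻¹ := by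
    refine hasSum_le (fun n => ?_) h hg
    simp only [mul_zero, zero_mul, Real.cos_zero, mul_one]
    rw [show 2 * r * r ^ n = 2 * r ^ (n + 1) by ring, hr, ← Real.exp_nat_mul]
    refine mul_le_mul_of_nonneg_left (Real.exp_le_exp.2 ?_) zero_le_two
    push_cast
    have : 0 ≤ Real.pi * x * (n * (n + 1)) := by
      have := Real.pi_pos
      positivity
    nlinarith
  refine hle.trans ?_
  -- With `r ≤ 1/23`, the factor `2 / (1 - r)` is at most `23/11 < 2.1`.
  rw [← div_eq_mul_inv, div_le_iff₀ (by linarith)]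
  nlinarith

/-- The tail on `(1, ∞)` of the theta kernel whose Mellin transform is the completed zeta
function. -/
noncomputable def thetaTail : ℝ → ℂ :=
  (Ioi 1).indicator fun x => ((evenKernel 0 x - 1 : ℝ) : ℂ)

theorem thetaTail_of_le {x : ℝ} (hx : x ≤ 1) : thetaTail x = 0 := by
  simp [thetaTail, hx]

theorem norm_thetaTail_le {x : ℝ} (hx : 1 < x) :
    ‖thetaTail x‖ ≤ 2.1 * Real.exp (-Real.pi * x) := by
  rw [thetaTail, indicator_of_mem (mem_Ioi.2 hx), Complex.norm_real, Real.norm_eq_abs,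
    abs_of_nonneg (evenKernel_zero_sub_one_nonneg (by linarith))]
  exact evenKernel_zero_sub_one_le hx.le

theorem integrableOn_pow_mul_exp_neg_pi (k : ℕ) :
    IntegrableOn (fun x : ℝ => x ^ k * Real.exp (-Real.pi * x)) (Ioi 1) := by
  have := integrableOn_rpow_mul_exp_neg_mul_rpow (s := k) (p := 1) (b := Real.pi)
    (by have : (0 : ℝ) ≤ k := by positivity
        linarith) one_pos Real.pi_pos
  simp only [Real.rpow_natCast, Real.rpow_one] at this
  exact this.mono_set (Ioi_subset_Ioi zero_le_one)

theorem norm_cpow_smul_thetaTail_le {u : ℂ} {k : ℕ} (hu : u.re - 1 ≤ k) {x : ℝ} (hx : 1 < x) :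
    ‖(x : ℂ) ^ (u - 1) • thetaTail x‖ ≤ 2.1 * (x ^ k * Real.exp (-Real.pi * x)) := by
  rw [norm_smul, Complex.norm_cpow_eq_rpow_re_of_pos (by linarith)]
  have h1 : x ^ (u - 1).re ≤ x ^ k := by
    rw [← Real.rpow_natCast]
    exact Real.rpow_le_rpow_of_exponent_le hx.le (by simpa using hu)
  calc _ ≤ x ^ k * (2.1 * Real.exp (-Real.pi * x)) := by
        gcongr
        exact norm_thetaTail_le hx
    _ = _ := by ring

theorem continuousOn_evenKernel_zero_sub_one :
    ContinuousOn (fun x => ((evenKernel 0 x - 1 : ℝ) : ℂ)) (Ioi 0) :=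
  Complex.continuous_ofReal.comp_continuousOn ((continuousOn_evenKernel 0).sub continuousOn_const)

theorem integrableOn_cpow_smul_thetaTail (u : ℂ) :
    IntegrableOn (fun x : ℝ => (x : ℂ) ^ (u - 1) • thetaTail x) (Ioi 1) := by
  obtain ⟨k, hk⟩ := exists_nat_ge (u.re - 1)
  refine Integrable.mono' ((integrableOn_pow_mul_exp_neg_pi k).const_mul 2.1) ?_
    ((ae_restrict_mem measurableSet_Ioi).mono fun x hx => norm_cpow_smul_thetaTail_le hk hx)
  refine ContinuousOn.aestronglyMeasurable ?_ measurableSet_Ioi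
  refine ContinuousOn.smul (f := fun x : ℝ => (x : ℂ) ^ (u - 1)) (fun x hx => ?_) ?_
  · have : 0 < x := zero_lt_one.trans hx
    exact (Complex.continuousAt_ofReal_cpow_const x (u - 1) (Or.inr this.ne')).continuousWithinAt
  · refine ContinuousOn.congr (continuousOn_evenKernel_zero_sub_one.mono
      (Ioi_subset_Ioi zero_le_one)) fun x hx => ?_
    rw [thetaTail, indicator_of_mem hx]

theorem mellinConvergent_thetaTail (u : ℂ) : MellinConvergent thetaTail u := by
  rw [MellinConvergent, ← Ioc_union_Ioi_eq_Ioi zero_le_one]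
  refine IntegrableOn.union ?_ (integrableOn_cpow_smul_thetaTail u)
  refine integrableOn_zero.congr_fun (fun x hx => ?_) measurableSet_Ioc
  simp [thetaTail_of_le hx.2]

theorem norm_mellin_thetaTail_le {u : ℂ} {k : ℕ} (hu : u.re - 1 ≤ k) :
    ‖mellin thetaTail u‖ ≤ 2.1 * ∫ x in Ioi (1 : ℝ), x ^ k * Real.exp (-Real.pi * x) := by
  have h : mellin thetaTail u = ∫ x in Ioi (1 : ℝ), (x : ℂ) ^ (u - 1) • thetaTail x := by
    rw [mellin]
    refine (setIntegral_eq_of_subset_of_forall_sdiff_eq_zero measurableSet_Ioi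
      (Ioi_subset_Ioi zero_le_one) fun x hx => ?_)
    simp [thetaTail_of_le (not_lt.1 hx.2)]
  rw [h, ← integral_const_mul]
  exact norm_integral_le_of_norm_le ((integrableOn_pow_mul_exp_neg_pi k).const_mul 2.1)
    ((ae_restrict_mem measurableSet_Ioi).mono fun x hx => norm_cpow_smul_thetaTail_le hu hx)

/-- Riemann's splitting of the Mellin integral at 1: the theta functional equation turns the piece
over `(0, 1)` into `x^(-1/2)` times the tail at `1/x`. Both terms then involve only the
exponentially small tail. -/
theorem completedRiemannZeta₀_eq_mellin (s : ℂ) :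
    completedRiemannZeta₀ s = (mellin thetaTail (s / 2) + mellin thetaTail ((1 - s) / 2)) / 2 := by
  have hB : mellin (fun t : ℝ => (t : ℂ) ^ (-(1 / 2) : ℂ) • thetaTail t⁻¹) (s / 2)
      = mellin thetaTail ((1 - s) / 2) := by
    rw [mellin_cpow_smul (fun t : ℝ => thetaTail t⁻¹), mellin_comp_inv]
    congr 1; ring
  have hBc : MellinConvergent (fun t : ℝ => (t : ℂ) ^ (-(1 / 2) : ℂ) • thetaTail t⁻¹) (s / 2) := by
    rw [MellinConvergent.cpow_smul (f := fun t : ℝ => thetaTail t⁻¹)]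
    have := MellinConvergent.comp_rpow (f := thetaTail) (s := s / 2 + -(1 / 2)) (a := -1)
      (by norm_num)
    simp only [Real.rpow_neg_one] at this
    exact this.2 (mellinConvergent_thetaTail _)
  rw [completedRiemannZeta₀, completedHurwitzZetaEven₀, WeakFEPair.Λ₀, ← hB,
    ← (hasMellin_add (mellinConvergent_thetaTail _) hBc).2]
  congr 1
  refine setIntegral_congr_fun measurableSet_Ioi fun x (hx : 0 < x) => ?_
  dsimp only
  congr 1
  simp only [WeakFEPair.f_modif, hurwitzEvenFEPair, Pi.add_apply]
  congr 1
  · simp [thetaTail]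
  · by_cases hx1 : x < 1
    · have h1 : 1 < x⁻¹ := (one_lt_inv₀ hx).2 hx1
      rw [indicator_of_mem (mem_Ioo.2 ⟨hx, hx1⟩), thetaTail, indicator_of_mem (mem_Ioi.2 h1)]
      have hfe := evenKernel_functional_equation 0 x
      rw [← evenKernel_eq_cosKernel_of_zero, one_div x] at hfe
      have hc : (x : ℂ) ^ (-(1 / 2) : ℂ) = ((x ^ (-(1 / 2) : ℝ) : ℝ) : ℂ) := by
        rw [Complex.ofReal_cpow hx.le]; norm_num
      simp only [Function.comp_apply, smul_eq_mul, hc]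
      rw [hfe, Real.rpow_neg hx.le]
      push_cast
      ring
    · rw [indicator_of_notMem (fun h => hx1 h.2), thetaTail_of_le (inv_le_one_of_one_le₀
        (not_lt.1 hx1)), smul_zero]

theorem integral_exp_neg_pi_le :
    ∫ x in Ioi (1 : ℝ), x ^ 0 * Real.exp (-Real.pi * x) ≤ 0.01385 := by
  have h : ∫ x in Ioi (1 : ℝ), x ^ 0 * Real.exp (-Real.pi * x)
      = Real.exp (-Real.pi) / Real.pi := by
    simp only [pow_zero, one_mul]
    rw [integral_exp_mul_Ioi (neg_lt_zero.2 Real.pi_pos)]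
    simp [neg_div_neg_eq]
  rw [h, div_le_iff₀ Real.pi_pos]
  nlinarith [exp_neg_pi_le, Real.pi_gt_d2]

theorem integral_sq_mul_exp_neg_pi_le :
    ∫ x in Ioi (1 : ℝ), x ^ 2 * Real.exp (-Real.pi * x) ≤ 0.0256 := by
  have hpi := Real.pi_pos
  -- Antiderivative obtained by integrating by parts twice.
  set F : ℝ → ℝ := fun x =>
    -(Real.exp (-Real.pi * x) * (x ^ 2 / Real.pi + 2 * x / Real.pi ^ 2 + 2 / Real.pi ^ 3)) with hF
  have hd : ∀ x ∈ Ici (1 : ℝ), HasDerivAt F (x ^ 2 * Real.exp (-Real.pi * x)) x := by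
    intro x _
    have h1 : HasDerivAt (fun x : ℝ => Real.exp (-Real.pi * x))
        (Real.exp (-Real.pi * x) * (-Real.pi)) x := by
      simpa using ((hasDerivAt_id x).const_mul (-Real.pi)).exp
    have h2 : HasDerivAt (fun x : ℝ => x ^ 2 / Real.pi + 2 * x / Real.pi ^ 2 + 2 / Real.pi ^ 3)
        (2 * x / Real.pi + 2 / Real.pi ^ 2) x := by
      have := (((hasDerivAt_pow 2 x).div_const Real.pi).add
        (((hasDerivAt_id x).const_mul 2).div_const (Real.pi ^ 2))).add_const (2 / Real.pi ^ 3)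
      simpa using this
    refine (h1.mul h2).neg.congr_deriv ?_
    field_simp
    ring
  have ht : Tendsto F atTop (𝓝 0) := by
    have hk (k : ℕ) : Tendsto (fun x : ℝ => x ^ k * Real.exp (-Real.pi * x)) atTop (𝓝 0) := by
      have := tendsto_rpow_mul_exp_neg_mul_atTop_nhds_zero k Real.pi hpi
      simpa using this
    have := ((((hk 2).div_const Real.pi).add
      (((hk 1).const_mul 2).div_const (Real.pi ^ 2))).add
        (((hk 0).const_mul 2).div_const (Real.pi ^ 3))).neg
    simp only [zero_div, mul_zero, add_zero, neg_zero] at this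
    refine this.congr fun x => ?_
    simp only [hF]
    ring
  have h := integral_Ioi_of_hasDerivAt_of_tendsto' hd (integrableOn_pow_mul_exp_neg_pi 2) ht
  rw [h]
  have h1 : 1 / Real.pi ≤ 1 / 3.14 := one_div_le_one_div_of_le (by norm_num) Real.pi_gt_d2.le
  set q := 1 / Real.pi with hq
  have hq0 : 0 < q := by positivity
  have e : 0 - F 1 = Real.exp (-Real.pi) * (q + 2 * q ^ 2 + 2 * q ^ 3) := by
    simp only [hF, hq]; field_simp; ring_nf
  rw [e]
  calc _ ≤ (1 / 23) * ((1 / 3.14) + 2 * (1 / 3.14) ^ 2 + 2 * (1 / 3.14) ^ 3 : ℝ) := by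
        gcongr
        exact exp_neg_pi_le
    _ ≤ _ := by norm_num

end HurwitzZeta

/-! ### Size and zero-freeness of the ξ function near 0 -/

open HurwitzZeta

/-- The entire function `s (s - 1) Λ(s) - 1`, where `Λ` is the completed zeta function. -/
noncomputable def xiAux (s : ℂ) : ℂ := s * (s - 1) * completedRiemannZeta₀ s

theorem differentiable_xiAux : Differentiable ℂ xiAux := by
  have := differentiable_completedZeta₀
  unfold xiAux
  fun_prop

theorem norm_completedRiemannZeta₀_le_of_mem_strip {s : ℂ} (h0 : 0 ≤ s.re) (h1 : s.re ≤ 1) :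
    ‖completedRiemannZeta₀ s‖ ≤ 0.0292 := by
  have e1 : (s / 2).re = s.re / 2 := by simp
  have e2 : ((1 - s) / 2).re = (1 - s.re) / 2 := by simp
  have a := norm_mellin_thetaTail_le (u := s / 2) (k := 0) (by rw [e1]; push_cast; linarith)
  have b := norm_mellin_thetaTail_le (u := (1 - s) / 2) (k := 0) (by rw [e2]; push_cast; linarith)
  rw [completedRiemannZeta₀_eq_mellin, norm_div, Complex.norm_ofNat]
  have := norm_add_le (mellin thetaTail (s / 2)) (mellin thetaTail ((1 - s) / 2))
  have := integral_exp_neg_pi_le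
  linarith

theorem norm_completedRiemannZeta₀_le {s : ℂ} (hs : ‖s‖ ≤ 5) :
    ‖completedRiemannZeta₀ s‖ ≤ 0.0415 := by
  have e1 : (s / 2).re = s.re / 2 := by simp
  have e2 : ((1 - s) / 2).re = (1 - s.re) / 2 := by simp
  have hre := abs_le.1 ((Complex.abs_re_le_norm s).trans hs)
  have i0 := integral_exp_neg_pi_le
  have i2 := integral_sq_mul_exp_neg_pi_le
  rw [completedRiemannZeta₀_eq_mellin, norm_div, Complex.norm_ofNat]
  have := norm_add_le (mellin thetaTail (s / 2)) (mellin thetaTail ((1 - s) / 2))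
  -- One Mellin argument has real part at most 1, so exponent 0 suffices there. The other has real
  -- part at most 3, which is what exponent 2 allows.
  rcases le_total s.re 1 with h | h
  · have a := norm_mellin_thetaTail_le (u := s / 2) (k := 0) (by rw [e1]; push_cast; linarith)
    have b := norm_mellin_thetaTail_le (u := (1 - s) / 2) (k := 2)
      (by rw [e2]; push_cast; linarith)
    linarith
  · have a := norm_mellin_thetaTail_le (u := s / 2) (k := 2) (by rw [e1]; push_cast; linarith)
    have b := norm_mellin_thetaTail_le (u := (1 - s) / 2) (k := 0)
      (by rw [e2]; push_cast; linarith)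
    linarith

theorem norm_xiAux_le {s : ℂ} (hs : ‖s‖ ≤ 5) : ‖xiAux s‖ ≤ 1.245 := by
  rw [xiAux, norm_mul, norm_mul]
  have h1 : ‖s - 1‖ ≤ 6 := (norm_sub_le s 1).trans (by rw [norm_one]; linarith)
  calc ‖s‖ * ‖s - 1‖ * ‖completedRiemannZeta₀ s‖ ≤ 5 * 6 * 0.0415 := by
        gcongr
        exact norm_completedRiemannZeta₀_le hs
    _ ≤ _ := by norm_num

theorem xiAux_one_sub (s : ℂ) : xiAux (1 - s) = xiAux s := by
  rw [xiAux, xiAux, completedRiemannZeta₀_one_sub]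
  ring

theorem one_add_xiAux {s : ℂ} (h0 : s ≠ 0) (h1 : s ≠ 1) :
    1 + xiAux s = s * (s - 1) * completedRiemannZeta s := by
  have : 1 - s ≠ 0 := sub_ne_zero.2 h1.symm
  rw [completedRiemannZeta_eq, xiAux]
  field_simp
  ring

theorem one_add_xiAux_ne_zero_of_one_le_re {s : ℂ} (hs : 1 ≤ s.re) : 1 + xiAux s ≠ 0 := by
  rcases eq_or_ne s 1 with rfl | h1
  · simp [xiAux]
  have h0 : s ≠ 0 := by rintro rfl; norm_num at hs
  rw [one_add_xiAux h0 h1]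
  have hz := riemannZeta_ne_zero_of_one_le_re hs
  rw [riemannZeta_def_of_ne_zero h0] at hz
  exact mul_ne_zero (mul_ne_zero h0 (sub_ne_zero.2 h1)) (fun h => hz (by rw [h, zero_div]))

/-- Zero-freeness of ζ on `Re s ≥ 1` and the functional equation leave only the critical strip,
where `|xiAux s| ≤ 5.1 * 6.1 * 0.0292 < 1`. The radius exceeds 5 so that the logarithm is
holomorphic on a neighbourhood of the circle `|s| = 5`. -/
theorem one_add_xiAux_ne_zero {s : ℂ} (hs : ‖s‖ < 5.1) : 1 + xiAux s ≠ 0 := by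
  rcases le_total 1 s.re with h | h
  · exact one_add_xiAux_ne_zero_of_one_le_re h
  rcases le_total s.re 0 with h' | h'
  · rw [← xiAux_one_sub]
    exact one_add_xiAux_ne_zero_of_one_le_re (by simpa using h')
  intro h2
  have h3 : ‖xiAux s‖ = 1 := by
    rw [← norm_neg, neg_eq_of_add_eq_zero_left h2, norm_one]
  rw [xiAux, norm_mul, norm_mul] at h3
  have h1 : ‖s - 1‖ ≤ 6.1 := (norm_sub_le s 1).trans (by rw [norm_one]; linarith)
  have : ‖s‖ * ‖s - 1‖ * ‖completedRiemannZeta₀ s‖ ≤ 5.1 * 6.1 * 0.0292 := by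
    gcongr
    exact norm_completedRiemannZeta₀_le_of_mem_strip h' h
  norm_num at this
  linarith

/-! ### Coefficient bounds for the logarithm of ξ -/

open Metric Set Real in
theorem iteratedDeriv_div_factorial_eq_circleAverage {f : ℂ → ℂ} {R ρ : ℝ} (hR : 0 < R)
    (hρ : R < ρ) (hf : DifferentiableOn ℂ f (ball 0 ρ)) (k : ℕ) :
    iteratedDeriv k f 0 / (k.factorial : ℂ) = circleAverage (fun z => (z⁻¹) ^ k * f z) 0 R := by
  lift R to NNReal using hR.le
  have hf' : DifferentiableOn ℂ f (closedBall 0 R) := hf.mono (closedBall_subset_ball hρ)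
  have h1 := (hf'.hasFPowerSeriesOnBall (by exact_mod_cast hR)).hasFPowerSeriesAt
  have h2 := (hf.analyticAt (ball_mem_nhds 0 (hR.trans hρ))).hasFPowerSeriesAt
  have h3 := congr_arg (fun p => p.coeff k) (h2.eq_formalMultilinearSeries h1)
  simp only [FormalMultilinearSeries.coeff_ofScalars] at h3
  rw [h3, circleAverage_eq_circleIntegral hR.ne', FormalMultilinearSeries.coeff,
    show (1 : Fin k → ℂ) = fun _ => 1 from rfl, cauchyPowerSeries_apply]
  congr 1
  simp only [sub_zero, one_div, smul_eq_mul]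
  congr 1
  ext z
  ring

open Metric Set Real in
/-- The coefficient form of the Borel–Carathéodory inequality. -/
theorem norm_iteratedDeriv_div_factorial_le_of_re_le {f : ℂ → ℂ} {R ρ A : ℝ} (hR : 0 < R)
    (hρ : R < ρ) (hf : DifferentiableOn ℂ f (ball 0 ρ)) (hA : ∀ z, ‖z‖ = R → (f z).re ≤ A)
    {k : ℕ} (hk : k ≠ 0) :
    ‖iteratedDeriv k f 0 / (k.factorial : ℂ)‖ * R ^ k ≤ 2 * (A - (f 0).re) := by
  have hsub : closedBall (0 : ℂ) |R| ⊆ ball 0 ρ := by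
    rw [abs_of_pos hR]; exact closedBall_subset_ball hρ
  have hsph : sphere (0 : ℂ) R ⊆ ball 0 ρ := by
    refine sphere_subset_closedBall.trans ?_
    rwa [abs_of_pos hR] at hsub
  have hcf : ContinuousOn f (sphere 0 R) := hf.continuousOn.mono hsph
  have hcc : ContinuousOn (fun z => (starRingEnd ℂ) (f z)) (sphere 0 R) :=
    Complex.continuous_conj.comp_continuousOn hcf
  have hci : ContinuousOn (fun z : ℂ => (z⁻¹) ^ k) (sphere 0 R) := by
    refine ContinuousOn.pow (continuousOn_inv₀.mono fun z hz => ?_) k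
    rintro rfl
    simp only [mem_sphere_iff_norm, sub_zero, norm_zero] at hz
    exact hR.ne hz
  -- On `|z| = R` one has `z⁻¹ = conj z / R^2`, so the integrand is `R^(-2k)` times the conjugate of
  -- `z^k g(z)`, whose mean is its value 0 at the centre.
  have key (g : ℂ → ℂ) (hg : DifferentiableOn ℂ g (ball 0 ρ)) :
      circleAverage (fun z => (z⁻¹) ^ k * (starRingEnd ℂ) (g z)) 0 R = 0 := by
    have hd : DifferentiableOn ℂ (fun z => z ^ k * g z) (ball 0 ρ) := by fun_prop
    have h1 : circleAverage (fun z => z ^ k * g z) 0 R = 0 := by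
      have := DiffContOnCl.circleAverage (f := fun z => z ^ k * g z) (c := 0) (R := R)
        (hd.mono (closure_ball_subset_closedBall.trans hsub)).diffContOnCl
      rw [this]; simp [hk]
    have h2 : CircleIntegrable (fun z => z ^ k * g z) 0 R :=
      ContinuousOn.circleIntegrable hR.le (hd.continuousOn.mono hsph)
    have h3 := (Complex.conjCLE : ℂ →L[ℝ] ℂ).circleAverage_comp_comm h2
    rw [h1, map_zero] at h3
    have h4 : circleAverage (fun z => (z⁻¹) ^ k * (starRingEnd ℂ) (g z)) 0 R =
        circleAverage (((R : ℂ) ^ (2 * k))⁻¹ •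
          (((Complex.conjCLE : ℂ →L[ℝ] ℂ) : ℂ → ℂ) ∘ fun z => z ^ k * g z)) 0 R := by
      refine circleAverage_congr_sphere fun z hz => ?_
      rw [abs_of_pos hR, mem_sphere_iff_norm, sub_zero] at hz
      have h5 : z * (starRingEnd ℂ) z = (R : ℂ) ^ 2 := by
        rw [Complex.mul_conj, Complex.normSq_eq_norm_sq, hz]; push_cast; ring
      have h6 : z ≠ 0 := by rintro rfl; rw [norm_zero] at hz; exact hR.ne hz
      have h7 : (R : ℂ) ≠ 0 := by exact_mod_cast hR.ne'
      simp only [Pi.smul_apply, Function.comp_apply, ContinuousLinearEquiv.coe_coe,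
        Complex.conjCLE_apply, map_mul, map_pow, smul_eq_mul]
      rw [pow_mul, ← h5, mul_pow, inv_pow]
      have h8 : (starRingEnd ℂ) z ≠ 0 := by simpa using h6
      field_simp
    rw [h4, circleAverage_smul, h3, smul_zero]
  have hA2 := key (fun _ => (2 * A : ℝ)) (by fun_prop)
  have hf2 := key f hf
  have i1 : CircleIntegrable (fun z => (z⁻¹) ^ k * f z) 0 R :=
    (hci.mul hcf).circleIntegrable hR.le
  have i2 : CircleIntegrable (fun z => (z⁻¹) ^ k * (starRingEnd ℂ) (f z)) 0 R :=
    (hci.mul hcc).circleIntegrable hR.le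
  have i3 : CircleIntegrable
      (fun z => (z⁻¹) ^ k * (starRingEnd ℂ) (((2 * A : ℝ) : ℂ))) 0 R :=
    (hci.mul continuousOn_const).circleIntegrable hR.le
  -- By `key`, adding `conj f` and subtracting `2 A` costs nothing. The new factor `2 Re f - 2 A`
  -- has constant sign, so the mean of its absolute value is computed by the mean value property.
  have e : circleAverage (fun z => (z⁻¹) ^ k * f z) 0 R =
      circleAverage (fun z => (z⁻¹) ^ k * ((2 * (f z).re - 2 * A : ℝ) : ℂ)) 0 R := by
    have h := circleAverage_fun_sub (i1.add i2) i3
    rw [hA2, sub_zero] at h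
    have h' := circleAverage_fun_add i1 i2
    rw [hf2, add_zero] at h'
    rw [← h']
    refine Eq.trans h.symm (congr_arg (circleAverage · 0 R) (funext fun z => ?_))
    simp only [Pi.add_apply, Complex.conj_ofReal]
    rw [← mul_add, Complex.add_conj, ← mul_sub]
    push_cast
    rfl
  have hre : circleAverage (fun z => 2 * A - 2 * (f z).re) 0 R = 2 * (A - (f 0).re) := by
    have h1 := DiffContOnCl.circleAverage (f := fun z => (2 * A : ℂ) - 2 * f z) (c := 0) (R := R)
      (((hf.mono (closure_ball_subset_closedBall.trans hsub)).const_mul 2).const_sub _).diffContOnCl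
    have h2 := Complex.reCLM.circleAverage_comp_comm (c := 0) (R := R)
      (f := fun z => (2 * A : ℂ) - 2 * f z)
      ((continuousOn_const.sub (continuousOn_const.mul hcf)).circleIntegrable hR.le)
    rw [h1] at h2
    have h3 : (Complex.reCLM ∘ fun z => (2 * A : ℂ) - 2 * f z) =
        fun z => 2 * A - 2 * (f z).re := by
      ext z
      simp
    rw [h3] at h2
    rw [h2]
    simp
    ring
  rw [iteratedDeriv_div_factorial_eq_circleAverage hR hρ hf, e, ← hre, circleAverage,
    circleAverage, norm_smul, smul_eq_mul, Real.norm_of_nonneg (by positivity), mul_assoc]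
  gcongr
  have h1 := intervalIntegral.norm_integral_le_integral_norm (μ := MeasureTheory.volume)
    (f := fun θ => ((circleMap 0 R θ)⁻¹) ^ k * ((2 * (f (circleMap 0 R θ)).re - 2 * A : ℝ) : ℂ))
    Real.two_pi_pos.le
  refine (mul_le_mul_of_nonneg_right h1 (by positivity)).trans_eq ?_
  rw [← intervalIntegral.integral_mul_const]
  congr 1
  ext θ
  have hn : ‖circleMap 0 R θ‖ = R := by simp [abs_of_pos hR]
  rw [norm_mul, norm_pow, norm_inv, hn, Complex.norm_real, Real.norm_eq_abs,
    abs_of_nonpos (by linarith [hA _ hn])]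
  have : R ^ k ≠ 0 := (pow_pos hR k).ne'
  rw [inv_pow]
  field_simp
  ring

open Metric Set in
-- A primitive `G` of the logarithmic derivative exists on the zero-free disc. The product `(1 +
-- xiAux) exp(-G)` has zero derivative and equals 1 at 0, so `G` is a holomorphic logarithm.
theorem exists_exp_eq_one_add_xiAux : ∃ G : ℂ → ℂ, G 0 = 0 ∧
    ∀ z ∈ ball (0 : ℂ) 5.1, HasDerivAt G (deriv xiAux z / (1 + xiAux z)) z ∧
      Complex.exp (G z) = 1 + xiAux z := by
  have hne : ∀ z ∈ ball (0 : ℂ) 5.1, 1 + xiAux z ≠ 0 := fun z hz =>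
    one_add_xiAux_ne_zero (by simpa using hz)
  have hd : DifferentiableOn ℂ (fun z => deriv xiAux z / (1 + xiAux z)) (ball 0 5.1) :=
    DifferentiableOn.div (differentiable_xiAux.differentiableOn.deriv isOpen_ball)
      (differentiable_xiAux.differentiableOn.const_add 1) hne
  obtain ⟨G, hG0, hG⟩ := hd.isExactOn_ball.with_val_at 0 0
  refine ⟨G, hG0, fun z hz => ⟨hG z hz, ?_⟩⟩
  have hφ : ∀ z ∈ ball (0 : ℂ) 5.1,
      HasDerivAt (fun z => (1 + xiAux z) * Complex.exp (-G z)) 0 z := by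
    intro z hz
    have h1 := ((differentiable_xiAux z).hasDerivAt.const_add 1).mul (hG z hz).neg.cexp
    refine h1.congr_deriv ?_
    have := hne z hz
    simp only [Pi.neg_apply]
    field_simp
    ring
  have h0 : (0 : ℂ) ∈ ball (0 : ℂ) 5.1 := mem_ball_self (by norm_num)
  have hc := isOpen_ball.is_const_of_deriv_eq_zero (convex_ball (0 : ℂ) 5.1).isPreconnected
    (fun z hz => (hφ z hz).differentiableAt.differentiableWithinAt)
    (fun z hz => (hφ z hz).deriv) hz h0
  simp only [hG0, xiAux, zero_mul, neg_zero, Complex.exp_zero, mul_one, add_zero] at hc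
  rw [Complex.exp_neg] at hc
  have := Complex.exp_ne_zero (G z)
  rw [← div_eq_mul_inv, div_eq_one_iff_eq this] at hc
  rw [← hc, xiAux]

open Metric Set in
-- Here `c n` is `n + 1` times the Taylor coefficient of index `n + 1` of `G`. Since `G 0 = 0` and
-- `Re G ≤ log 2.245 ≤ 0.9` on `|z| = 5`, Borel–Carathéodory yields the constant `1.8 = 2 * 0.9`.
theorem exists_hasSum_logDeriv_one_add_xiAux : ∃ c : ℕ → ℂ,
    (∀ n, ‖c n‖ * 5 ^ (n + 1) ≤ 1.8 * (n + 1)) ∧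
    ∀ s : ℂ, ‖s‖ < 5 → HasSum (fun n => c n * s ^ n) (deriv xiAux s / (1 + xiAux s)) := by
  obtain ⟨G, hG0, hG⟩ := exists_exp_eq_one_add_xiAux
  have hGd : DifferentiableOn ℂ G (ball 0 5.1) :=
    fun z hz => (hG z hz).1.differentiableAt.differentiableWithinAt
  have hball : ball (0 : ℂ) 5 ⊆ ball 0 5.1 := ball_subset_ball (by norm_num)
  refine ⟨fun n => iteratedDeriv (n + 1) G 0 / (n.factorial : ℂ), fun n => ?_, fun s hs => ?_⟩
  · have h := norm_iteratedDeriv_div_factorial_le_of_re_le (R := 5) (A := 0.9) (by norm_num)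
      (by norm_num) hGd (fun z hz => ?_) n.succ_ne_zero
    · have e : iteratedDeriv (n + 1) G 0 / (n.factorial : ℂ) =
          (n + 1 : ℕ) * (iteratedDeriv (n + 1) G 0 / ((n + 1).factorial : ℂ)) := by
        have : (n.factorial : ℂ) ≠ 0 := by exact_mod_cast n.factorial_ne_zero
        have : ((n + 1 : ℕ) : ℂ) ≠ 0 := by exact_mod_cast n.succ_ne_zero
        rw [Nat.factorial_succ]
        push_cast at *
        field_simp
      beta_reduce
      rw [e, norm_mul, Complex.norm_natCast, mul_assoc]
      rw [hG0, Complex.zero_re] at h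
      calc _ ≤ ((n + 1 : ℕ) : ℝ) * (2 * (0.9 - 0)) := by gcongr
        _ = _ := by push_cast; ring
    · have h1 : ‖Complex.exp (G z)‖ ≤ 2.245 := by
        rw [(hG z (by simp [hz]; norm_num)).2]
        refine (norm_add_le _ _).trans ?_
        rw [norm_one]
        linarith [norm_xiAux_le hz.le]
      rw [Complex.norm_exp] at h1
      have h2 : (2.245 : ℝ) ≤ Real.exp 0.9 := by
        have := Real.quadratic_le_exp_of_nonneg (x := 0.9) (by norm_num)
        norm_num at this ⊢; linarith
      exact Real.exp_le_exp.1 (h1.trans h2)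
  · have hs' : s ∈ ball (0 : ℂ) 5 := by simpa using hs
    have hd : EqOn (deriv G) (fun z => deriv xiAux z / (1 + xiAux z)) (ball 0 5.1) :=
      fun z hz => (hG z hz).1.deriv
    have h := Complex.hasSum_taylorSeries_on_ball (f := deriv G)
      ((hGd.deriv isOpen_ball).mono hball) hs'
    rw [hd (hball hs')] at h
    refine h.congr_fun fun n => ?_
    beta_reduce
    rw [iteratedDeriv_succ', sub_zero, smul_eq_mul, smul_eq_mul]
    ring

/-! ### Uniqueness of power series coefficients; Dirichlet series of `zetaNat` -/

open Filter Topology in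
-- Agreement on a real neighbourhood of 0 is enough, so the digamma expansion and the reality of the
-- coefficients need only be examined at real points.
theorem eq_of_eventually_hasSum_ofReal_pow {a b : ℕ → ℂ} {f : ℝ → ℂ}
    (ha : ∀ᶠ x : ℝ in 𝓝 0, HasSum (fun n => a n * (x : ℂ) ^ n) (f x))
    (hb : ∀ᶠ x : ℝ in 𝓝 0, HasSum (fun n => b n * (x : ℂ) ^ n) (f x)) : a = b := by
  let p (c : ℕ → ℂ) : FormalMultilinearSeries ℝ ℝ ℂ :=
    fun n => ContinuousMultilinearMap.mkPiRing ℝ (Fin n) (c n)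
  have hp (c : ℕ → ℂ) (n : ℕ) : (p c).coeff n = c n := by
    simp [p, FormalMultilinearSeries.coeff]
  have key (c : ℕ → ℂ) (hc : ∀ᶠ x : ℝ in 𝓝 0, HasSum (fun n => c n * (x : ℂ) ^ n) (f x)) :
      HasFPowerSeriesAt f (p c) 0 := by
    refine hasFPowerSeriesAt_iff.2 (hc.mono fun x hx => ?_)
    rw [zero_add]
    refine hx.congr_fun fun n => ?_
    rw [hp, Complex.real_smul, mul_comm, Complex.ofReal_pow]
  have h := (key a ha).eq_formalMultilinearSeries (key b hb)
  ext n
  rw [← hp a, ← hp b, h]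

theorem zetaNat_eq_tsum {k : ℕ} (hk : 1 < k) : zetaNat k = ∑' n : ℕ, 1 / ((n : ℝ) + 1) ^ k := by
  have hs : Summable fun n : ℕ => 1 / (n : ℝ) ^ k := Real.summable_one_div_nat_pow.2 hk
  have h : riemannZeta k = ((∑' n : ℕ, 1 / (n : ℝ) ^ k : ℝ) : ℂ) := by
    rw [zeta_nat_eq_tsum_of_gt_one hk]
    push_cast
    rfl
  rw [zetaNat, h, Complex.ofReal_re, hs.tsum_eq_zero_add]
  simp [(zero_lt_one.trans hk).ne']

theorem summable_one_div_add_one_pow {k : ℕ} (hk : 1 < k) :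
    Summable fun n : ℕ => 1 / ((n : ℝ) + 1) ^ k := by
  have := (summable_nat_add_iff 1).2 (Real.summable_one_div_nat_pow.2 hk)
  simpa using this

/-! ### Taylor series of the digamma function at 1 -/

namespace Real
open Filter Topology Set

theorem differentiableAt_log_Gamma {x : ℝ} (hx : 0 < x) :
    DifferentiableAt ℝ (log ∘ Gamma) x :=
  (differentiableAt_Gamma fun m => by
    have : (0 : ℝ) ≤ m := m.cast_nonneg
    linarith).log (Gamma_pos_of_pos hx).ne'

theorem deriv_log_Gamma_add_one {x : ℝ} (hx : 0 < x) :
    deriv (log ∘ Gamma) (x + 1) = deriv (log ∘ Gamma) x + 1 / x := by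
  rw [← deriv_comp_add_const, one_div, ← deriv_log,
    ← deriv_add (differentiableAt_log_Gamma hx) (differentiableAt_log hx.ne')]
  refine EventuallyEq.deriv_eq ?_
  filter_upwards [eventually_gt_nhds hx] with y hy
  simp only [Function.comp_apply, Pi.add_apply]
  rw [Gamma_add_one hy.ne', log_mul hy.ne' (Gamma_pos_of_pos hy).ne', add_comm]

theorem monotoneOn_deriv_log_Gamma : MonotoneOn (deriv (log ∘ Gamma)) (Ioi 0) :=
  convexOn_log_Gamma.monotoneOn_deriv fun _ hx => differentiableAt_log_Gamma hx

theorem sum_one_div_add_eq_deriv_log_Gamma {x : ℝ} (hx : 0 < x) (n : ℕ) :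
    ∑ k ∈ Finset.range n, 1 / (x + k) =
      deriv (log ∘ Gamma) (x + n) - deriv (log ∘ Gamma) x := by
  induction n with
  | zero => simp
  | succ n ih =>
    rw [Finset.sum_range_succ, ih, Nat.cast_succ, ← add_assoc,
      deriv_log_Gamma_add_one (by positivity)]
    ring

/-- Log-convexity makes ψ monotone. After shifting `n` by 1, both values lie between `ψ(n + 1)` and
`ψ(n + 3)`, which differ by `1/(n + 1) + 1/(n + 2)`. -/
theorem tendsto_deriv_log_Gamma_sub {x : ℝ} (hx : |x| < 1) :
    Tendsto (fun n : ℕ => deriv (log ∘ Gamma) (1 + n) - deriv (log ∘ Gamma) (1 + x + n))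
      atTop (𝓝 0) := by
  obtain ⟨h1, h2⟩ := abs_lt.1 hx
  rw [← tendsto_add_atTop_iff_nat 1]
  have hlim : Tendsto (fun n : ℕ => 1 / ((n : ℝ) + 1) + 1 / ((n + 1 : ℕ) + 1 : ℝ)) atTop (𝓝 0) := by
    have h := tendsto_one_div_add_atTop_nhds_zero_nat (𝕜 := ℝ)
    simpa using h.add ((tendsto_add_atTop_iff_nat 1).2 h)
  refine squeeze_zero_norm (fun n => ?_) hlim
  have hn : (0 : ℝ) ≤ n := n.cast_nonneg
  have e1 := deriv_log_Gamma_add_one (x := (n : ℝ) + 1) (by linarith)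
  have e2 := deriv_log_Gamma_add_one (x := (n : ℝ) + 1 + 1) (by linarith)
  have m1 := monotoneOn_deriv_log_Gamma (a := (n : ℝ) + 1) (b := 1 + ((n + 1 : ℕ) : ℝ))
    (by simp only [mem_Ioi]; linarith) (by simp only [mem_Ioi]; positivity) (by push_cast; linarith)
  have m2 := monotoneOn_deriv_log_Gamma (a := 1 + ((n + 1 : ℕ) : ℝ)) (b := (n : ℝ) + 1 + 1 + 1)
    (by simp only [mem_Ioi]; positivity) (by simp only [mem_Ioi]; positivity)
    (by push_cast; linarith)
  have m3 := monotoneOn_deriv_log_Gamma (a := (n : ℝ) + 1) (b := 1 + x + ((n + 1 : ℕ) : ℝ))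
    (by simp only [mem_Ioi]; linarith) (by simp only [mem_Ioi]; push_cast; linarith)
    (by push_cast; linarith)
  have m4 := monotoneOn_deriv_log_Gamma (a := 1 + x + ((n + 1 : ℕ) : ℝ)) (b := (n : ℝ) + 1 + 1 + 1)
    (by simp only [mem_Ioi]; push_cast; linarith) (by simp only [mem_Ioi]; positivity)
    (by push_cast; linarith)
  rw [Real.norm_eq_abs, abs_le]
  push_cast at *
  constructor <;> linarith

theorem hasSum_deriv_log_Gamma {x : ℝ} (hx : |x| < 1) :
    HasSum (fun n : ℕ => (-1) ^ n * zetaNat (n + 2) * x ^ (n + 1))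
      (deriv (log ∘ Gamma) (1 + x) - deriv (log ∘ Gamma) 1) := by
  have hx1 : 0 < 1 + x := by linarith [(abs_lt.1 hx).1]
  -- Double series summed in two ways: rows are geometric and give the partial-fraction terms of
  -- `ψ(1 + x) - ψ(1)`, while columns give the values `ζ(n + 2)`.
  set T : ℕ × ℕ → ℝ := fun p => (-1) ^ p.2 * x ^ (p.2 + 1) * (1 / ((p.1 : ℝ) + 1) ^ (p.2 + 2)) with hT
  have hsum : Summable T := by
    have h2 := (summable_one_div_add_one_pow one_lt_two).mul_of_nonneg
      (g := fun n => |x| ^ n) (summable_geometric_of_abs_lt_one (by rwa [abs_abs]))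
      (fun n => by positivity) (fun n => by positivity)
    refine Summable.of_norm_bounded h2 fun p => ?_
    simp only [hT, norm_mul, norm_pow, norm_neg, norm_one, one_pow, one_mul, norm_div,
      Real.norm_eq_abs]
    rw [mul_comm, abs_of_nonneg (by positivity : (0 : ℝ) ≤ p.1 + 1)]
    refine mul_le_mul ?_ (pow_le_pow_of_le_one (abs_nonneg x) hx.le (by omega)) (by positivity)
      (by positivity)
    refine one_div_le_one_div_of_le (by positivity) (pow_le_pow_right₀ ?_ (by omega))
    linarith [(p.1.cast_nonneg : (0 : ℝ) ≤ p.1)]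
  have hrow (k : ℕ) : HasSum (fun n => T (k, n)) (1 / (1 + k) - 1 / (1 + x + k)) := by
    have hk : (0 : ℝ) < k + 1 := by positivity
    have hr : |-x / (k + 1)| < 1 := by
      rw [abs_div, abs_neg, abs_of_pos hk, div_lt_one hk]
      linarith [(k.cast_nonneg : (0 : ℝ) ≤ k)]
    have h := (hasSum_geometric_of_abs_lt_one hr).mul_left (x / ((k : ℝ) + 1) ^ 2)
    have hne : 1 + x + (k : ℝ) ≠ 0 := by positivity
    have e : x / ((k : ℝ) + 1) ^ 2 * (1 - -x / (k + 1))⁻¹ = 1 / (1 + k) - 1 / (1 + x + k) := by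
      have h3 : 1 - -x / ((k : ℝ) + 1) = (1 + x + k) / (k + 1) := by field_simp; ring
      have h4 : (1 : ℝ) + k ≠ 0 := by positivity
      rw [h3]
      field_simp
      ring
    rw [e] at h
    refine h.congr_fun fun n => ?_
    simp only [hT]
    rw [div_pow, neg_pow x]
    field_simp
    ring
  have hcol (n : ℕ) : HasSum (fun k => T (k, n)) ((-1) ^ n * zetaNat (n + 2) * x ^ (n + 1)) := by
    have h := (summable_one_div_add_one_pow (k := n + 2) (by omega)).hasSum.mul_left
      ((-1) ^ n * x ^ (n + 1))
    rw [← zetaNat_eq_tsum (by omega)] at h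
    rwa [mul_right_comm] at h
  have h1 := (hsum.hasSum.prod_fiberwise hrow).tendsto_sum_nat
  have h2 := ((Equiv.prodComm ℕ ℕ).hasSum_iff.2 hsum.hasSum).prod_fiberwise hcol
  have h3 : Tendsto (fun n : ℕ => ∑ k ∈ Finset.range n, (1 / (1 + (k : ℝ)) - 1 / (1 + x + k))) atTop
      (𝓝 (deriv (log ∘ Gamma) (1 + x) - deriv (log ∘ Gamma) 1)) := by
    have h4 := (tendsto_deriv_log_Gamma_sub hx).add_const
      (deriv (log ∘ Gamma) (1 + x) - deriv (log ∘ Gamma) 1)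
    rw [zero_add] at h4
    refine h4.congr fun n => ?_
    rw [Finset.sum_sub_distrib, sum_one_div_add_eq_deriv_log_Gamma one_pos,
      sum_one_div_add_eq_deriv_log_Gamma hx1]
    ring
  rwa [tendsto_nhds_unique h1 h3] at h2

end Real

theorem Complex.digamma_ofReal {x : ℝ} (hx : 0 < x) :
    digamma x = ((deriv (Real.log ∘ Real.Gamma) x : ℝ) : ℂ) := by
  have hr : DifferentiableAt ℝ Real.Gamma x := Real.differentiableAt_Gamma fun m => by
    have : (0 : ℝ) ≤ m := m.cast_nonneg
    linarith
  have hc : DifferentiableAt ℂ Gamma x := differentiableAt_Gamma _ fun m h => by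
    have h' : x = -m := by exact_mod_cast h
    have : (0 : ℝ) ≤ m := m.cast_nonneg
    linarith
  have h1 : HasDerivAt (fun y : ℝ => Gamma y) (deriv Gamma x) x := hc.hasDerivAt.comp_ofReal
  simp only [Gamma_ofReal] at h1
  have h2 := h1.unique hr.hasDerivAt.ofReal_comp
  rw [Function.comp_def, deriv.log hr (Real.Gamma_pos_of_pos hx).ne', digamma_def, logDeriv_apply, h2,
    Gamma_ofReal, ofReal_div]

/-! ### Elementary inequalities for zeta values and powers -/

/-- Removing the Euler factor at 2 leaves the sum over odd integers. The term `5^(-k)` is needed: at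
`k = 2` the final comparison `3.6 < 25/9 + 1` fails without it. -/
theorem one_add_le_zetaNat_mul_one_sub {k : ℕ} (hk : 1 < k) :
    1 + 1 / 3 ^ k + 1 / 5 ^ k ≤ zetaNat k * (1 - 1 / 2 ^ k) := by
  have hs := summable_one_div_add_one_pow hk
  set a : ℕ → ℝ := fun n => 1 / ((n : ℝ) + 1) ^ k with ha
  have he : Summable fun n : ℕ => a (2 * n) :=
    hs.comp_injective (mul_right_injective₀ two_ne_zero)
  have ho : Summable fun n : ℕ => a (2 * n + 1) :=
    hs.comp_injective ((add_left_injective 1).comp (mul_right_injective₀ two_ne_zero))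
  have h1 := tsum_even_add_odd he ho
  have h2 : ∑' n : ℕ, a (2 * n + 1) = 1 / 2 ^ k * zetaNat k := by
    rw [zetaNat_eq_tsum hk, ← tsum_mul_left]
    refine tsum_congr fun n => ?_
    simp only [ha]
    rw [one_div_mul_one_div, ← mul_pow]
    push_cast
    ring_nf
  rw [← zetaNat_eq_tsum hk, h2] at h1
  have h3 := he.sum_le_tsum (Finset.range 3) fun n _ => by positivity
  have h4 : ∑ n ∈ Finset.range 3, a (2 * n) = 1 + 1 / 3 ^ k + 1 / 5 ^ k := by
    simp only [Finset.sum_range_succ, Finset.sum_range_zero, ha]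
    norm_num
  rw [h4] at h3
  linarith

theorem zetaNat_lt_two {k : ℕ} (hk : 1 < k) : zetaNat k < 2 := by
  have h2 : zetaNat 2 < 2 := by
    have : zetaNat 2 = Real.pi ^ 2 / 6 := by
      rw [zetaNat, Nat.cast_ofNat, riemannZeta_two]
      norm_cast
    rw [this]
    nlinarith [Real.pi_lt_d2, Real.pi_pos]
  refine lt_of_le_of_lt ?_ h2
  rw [zetaNat_eq_tsum hk, zetaNat_eq_tsum one_lt_two]
  refine (summable_one_div_add_one_pow hk).tsum_le_tsum (fun n => ?_)
    (summable_one_div_add_one_pow one_lt_two)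
  refine one_div_le_one_div_of_le (by positivity) (pow_le_pow_right₀ ?_ hk)
  linarith [(n.cast_nonneg : (0 : ℝ) ≤ n)]

theorem linear_lt_pow_and_le_pow {k : ℕ} (hk : 2 ≤ k) :
    (1.8 : ℝ) * k < (5 / 3) ^ k + 1 ∧ (25 / 9 : ℝ) ≤ (5 / 3) ^ k := by
  induction k, hk using Nat.le_induction with
  | base => norm_num
  | succ k _ ih =>
    rw [pow_succ]
    push_cast
    -- The second conjunct makes the power grow by at least `(2/3) * (25/9) > 1.8` at each step.
    constructor <;> linarith [ih.1, ih.2]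

/-! ### Splitting the logarithmic derivative of `(s - 1) ζ(s)` -/

open Complex in
theorem re_pos_of_norm_lt_two {s : ℂ} (hs : ‖s‖ < 2) : 0 < (s / 2 + 1).re := by
  have h := (abs_lt.1 ((abs_re_le_norm s).trans_lt hs)).1
  simp
  linarith

theorem Complex.ne_neg_nat_of_re_pos {z : ℂ} (hz : 0 < z.re) (m : ℕ) : z ≠ -m := by
  rintro rfl
  simp at hz
  linarith [(m.cast_nonneg : (0 : ℝ) ≤ m)]

/-- The logarithmic derivative of `(s - 1) ζ(s)`, split into the part coming from the completed
zeta function and the part coming from the Gamma factor. -/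
noncomputable def zetaLogDeriv (s : ℂ) : ℂ :=
  deriv xiAux s / (1 + xiAux s) + (Complex.log Real.pi / 2 - Complex.digamma (s / 2 + 1) / 2)

open Complex in
theorem sub_one_mul_riemannZeta {s : ℂ} (hs : s ≠ 1) (hs2 : 0 < (s / 2 + 1).re) :
    (s - 1) * riemannZeta s * ((Real.pi : ℂ) ^ (-s / 2) * Gamma (s / 2 + 1)) =
      (1 + xiAux s) / 2 := by
  have h1 : 1 - s ≠ 0 := sub_ne_zero.2 hs.symm
  have h2 : (Real.pi : ℂ) ≠ 0 := by exact_mod_cast Real.pi_ne_zero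
  have h3 : (Real.pi : ℂ) ^ (-s / 2) ≠ 0 := by simp [cpow_eq_zero_iff, h2]
  have h4 := Gamma_ne_zero (ne_neg_nat_of_re_pos hs2)
  rw [riemannZeta_eq_mul_completedRiemannZeta₀, xiAux]
  generalize Gamma (s / 2 + 1) = g at *
  field_simp
  ring

open Complex Filter Topology in
theorem deriv_riemannZeta_div_add {s : ℂ} (hs : ‖s‖ < 2) (h1 : s ≠ 1) :
    deriv riemannZeta s / riemannZeta s + 1 / (s - 1) = zetaLogDeriv s := by
  have hre := re_pos_of_norm_lt_two hs
  have hpi : (Real.pi : ℂ) ≠ 0 := by exact_mod_cast Real.pi_ne_zero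
  have hp : (Real.pi : ℂ) ^ (-s / 2) ≠ 0 := by simp [cpow_eq_zero_iff, hpi]
  have hG := Gamma_ne_zero (ne_neg_nat_of_re_pos hre)
  have hx : 1 + xiAux s ≠ 0 := one_add_xiAux_ne_zero (by linarith)
  have hE := sub_one_mul_riemannZeta h1 hre
  have hs1 : s - 1 ≠ 0 := sub_ne_zero.2 h1
  have hz : riemannZeta s ≠ 0 := by
    intro h
    rw [h, mul_zero, zero_mul] at hE
    exact hx (by linear_combination -2 * hE)
  have dp : HasDerivAt (fun s : ℂ => (Real.pi : ℂ) ^ (-s / 2))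
      ((Real.pi : ℂ) ^ (-s / 2) * log Real.pi * (-1 / 2)) s :=
    ((hasDerivAt_id s).neg.div_const 2).const_cpow (Or.inl hpi)
  have dG : HasDerivAt (fun s : ℂ => Gamma (s / 2 + 1)) (deriv Gamma (s / 2 + 1) * (1 / 2)) s :=
    (differentiableAt_Gamma _ (ne_neg_nat_of_re_pos hre)).hasDerivAt.comp s
      (((hasDerivAt_id s).div_const 2).add_const 1)
  have dz := (((hasDerivAt_id s).sub_const 1).mul
    (differentiableAt_riemannZeta h1).hasDerivAt).mul (dp.mul dG)
  have dx : HasDerivAt (fun s => (1 + xiAux s) / 2) (deriv xiAux s / 2) s :=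
    ((differentiable_xiAux s).hasDerivAt.const_add 1).div_const 2
  have hev : (fun s : ℂ => (1 + xiAux s) / 2) =ᶠ[𝓝 s] fun s =>
      (s - 1) * riemannZeta s * ((Real.pi : ℂ) ^ (-s / 2) * Gamma (s / 2 + 1)) := by
    have ho : IsOpen {s : ℂ | 0 < (s / 2 + 1).re} :=
      isOpen_lt continuous_const (by fun_prop)
    filter_upwards [isOpen_ne.mem_nhds h1, ho.mem_nhds hre] with t ht1 ht2
    exact (sub_one_mul_riemannZeta ht1 ht2).symm
  have hd := (dx.congr_of_eventuallyEq hev.symm).unique dz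
  have h5 : 1 + xiAux s =
      2 * ((s - 1) * riemannZeta s * ((Real.pi : ℂ) ^ (-s / 2) * Gamma (s / 2 + 1))) := by
    rw [hE]; ring
  have h6 : deriv xiAux s = 2 * (deriv xiAux s / 2) := by ring
  rw [zetaLogDeriv, digamma_def, logDeriv_apply, h5, h6, hd]
  simp only [id_eq, Pi.mul_apply]
  generalize Gamma (s / 2 + 1) = g at *
  field_simp
  ring

open Complex Metric in
theorem differentiableOn_zetaLogDeriv : DifferentiableOn ℂ zetaLogDeriv (ball 0 2) := by
  have ho : IsOpen {s : ℂ | 0 < s.re} := isOpen_lt continuous_const continuous_re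
  have hG : DifferentiableOn ℂ Gamma {s : ℂ | 0 < s.re} := fun z hz =>
    (differentiableAt_Gamma z (ne_neg_nat_of_re_pos hz)).differentiableWithinAt
  have hdig : DifferentiableOn ℂ digamma {s : ℂ | 0 < s.re} :=
    (hG.deriv ho).div hG fun z hz => Gamma_ne_zero (ne_neg_nat_of_re_pos hz)
  have hmaps : Set.MapsTo (fun s : ℂ => s / 2 + 1) (ball 0 2) {s : ℂ | 0 < s.re} :=
    fun s hs => re_pos_of_norm_lt_two (by simpa using hs)
  have h1 : DifferentiableOn ℂ (fun s : ℂ => digamma (s / 2 + 1)) (ball 0 2) :=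
    hdig.comp (by fun_prop) hmaps
  refine DifferentiableOn.add ?_ ((h1.div_const 2).const_sub _)
  exact DifferentiableOn.div (differentiable_xiAux.differentiableOn.deriv isOpen_ball)
    (differentiable_xiAux.differentiableOn.const_add 1)
    fun z hz => one_add_xiAux_ne_zero (by
      have : ‖z‖ < 2 := by simpa using hz
      linarith)

open Complex in
theorem riemannZeta_ofReal_im (x : ℝ) : (riemannZeta x).im = 0 := by
  rw [← conj_eq_iff_im, ← riemannZeta_conj, conj_ofReal]

open Complex in
theorem deriv_riemannZeta_ofReal_im {x : ℝ} (hx : x ≠ 1) : (deriv riemannZeta x).im = 0 := by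
  have h := (differentiableAt_riemannZeta (s := x) (by exact_mod_cast hx)).hasDerivAt
  have h1 := h.comp_ofReal
  have h2 := h.real_of_complex.ofReal_comp
  have e : (fun y : ℝ => (((riemannZeta y).re : ℝ) : ℂ)) = fun y : ℝ => riemannZeta y := by
    ext y
    exact conj_eq_iff_re.1 (conj_eq_iff_im.2 (riemannZeta_ofReal_im y))
  rw [e] at h2
  rw [h1.unique h2, ofReal_im]

open Complex in
theorem conj_zetaLogDeriv_ofReal {x : ℝ} (hx : |x| < 1) :
    (starRingEnd ℂ) (zetaLogDeriv x) = zetaLogDeriv x := by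
  have hx1 : x ≠ 1 := by rintro rfl; simp at hx
  have hx2 : ‖(x : ℂ)‖ < 2 := by rw [norm_real, Real.norm_eq_abs]; linarith
  rw [← deriv_riemannZeta_div_add hx2 (by exact_mod_cast hx1), map_add, map_div₀, map_div₀,
    conj_eq_iff_im.2 (riemannZeta_ofReal_im x), conj_eq_iff_im.2 (deriv_riemannZeta_ofReal_im hx1),
    map_sub, map_one, conj_ofReal]

open Filter Topology in
theorem eventually_abs_lt_one : ∀ᶠ x : ℝ in 𝓝 0, |x| < 1 := by
  filter_upwards [Metric.ball_mem_nhds (0 : ℝ) one_pos] with x hx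
  simpa using hx

open Complex Filter Topology Metric in
theorem hasSum_lehmerB {s : ℂ} (hs : ‖s‖ < 2) :
    HasSum (fun n => (lehmerB n : ℂ) * s ^ n) (zetaLogDeriv s) := by
  -- Only the germ at 0 enters `lehmerB`. The singularity at 1 is bypassed because `zetaLogDeriv` is
  -- holomorphic on the whole disc of radius 2.
  have hev : (fun s : ℂ => deriv riemannZeta s / riemannZeta s + 1 / (s - 1)) =ᶠ[𝓝 0]
      zetaLogDeriv := by
    filter_upwards [ball_mem_nhds (0 : ℂ) one_pos] with t ht
    have ht' : ‖t‖ < 1 := by simpa using ht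
    exact deriv_riemannZeta_div_add (by linarith) (by rintro rfl; simp at ht')
  set β : ℕ → ℂ := fun n => iteratedDeriv n zetaLogDeriv 0 / (n.factorial : ℂ) with hβ
  have hsum {s : ℂ} (hs : ‖s‖ < 2) : HasSum (fun n => β n * s ^ n) (zetaLogDeriv s) := by
    refine (hasSum_taylorSeries_on_ball differentiableOn_zetaLogDeriv
      (by simpa using hs : s ∈ ball 0 2)).congr_fun fun n => ?_
    simp only [hβ, sub_zero, smul_eq_mul]
    ring
  -- The function is real on the real axis near 0, so its series and the conjugated one agree there.
  have hreal : (fun n => (starRingEnd ℂ) (β n)) = β := by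
    refine eq_of_eventually_hasSum_ofReal_pow (f := fun x => zetaLogDeriv x) ?_ ?_
    · filter_upwards [eventually_abs_lt_one] with x hx
      have h := hsum (s := x) (by rw [norm_real, Real.norm_eq_abs]; linarith)
      have h' := h.map (starRingEnd ℂ) continuous_conj
      rw [conj_zetaLogDeriv_ofReal hx] at h'
      refine h'.congr_fun fun n => ?_
      simp
    · filter_upwards [eventually_abs_lt_one] with x hx
      exact hsum (s := x) (by rw [norm_real, Real.norm_eq_abs]; linarith)
  refine (hsum hs).congr_fun fun n => ?_
  rw [lehmerB, hev.iteratedDeriv_eq n]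
  congr 1
  exact conj_eq_iff_re.1 (congr_fun hreal n)

open Complex Filter Topology in
theorem exists_lehmerB_eq : ∃ c : ℕ → ℂ, (∀ n, ‖c n‖ * 5 ^ (n + 1) ≤ 1.8 * (n + 1)) ∧
    ∀ n, lehmerB (n + 1) = (c (n + 1)).re - (-1) ^ n * zetaNat (n + 2) / 2 ^ (n + 2) := by
  obtain ⟨c, hc, hsum⟩ := exists_hasSum_logDeriv_one_add_xiAux
  refine ⟨c, hc, ?_⟩
  set d : ℝ := deriv (Real.log ∘ Real.Gamma) 1
  obtain ⟨e, he0, hes⟩ : ∃ e : ℕ → ℝ, e 0 = Real.log Real.pi / 2 - d / 2 ∧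
      ∀ m, e (m + 1) = -((-1) ^ m * zetaNat (m + 2) / 2 ^ (m + 2)) :=
    ⟨fun n => Nat.casesOn n (Real.log Real.pi / 2 - d / 2)
      fun m => -((-1) ^ m * zetaNat (m + 2) / 2 ^ (m + 2)), rfl, fun _ => rfl⟩
  have he {x : ℝ} (hx : |x| < 1) : HasSum (fun n => e n * x ^ n)
      (Real.log Real.pi / 2 - deriv (Real.log ∘ Real.Gamma) (1 + x / 2) / 2) := by
    have h := (Real.hasSum_deriv_log_Gamma (x := x / 2)
      (by rw [abs_div, abs_two]; linarith)).mul_left (-(1 / 2))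
    have h' : HasSum (fun n => e (n + 1) * x ^ (n + 1))
        (-(1 / 2) * (deriv (Real.log ∘ Real.Gamma) (1 + x / 2) - d)) := by
      refine h.congr_fun fun n => ?_
      rw [hes, div_pow]
      field_simp
      ring
    have h2 := (hasSum_nat_add_iff (f := fun n => e n * x ^ n) 1).1 h'
    simp only [Finset.sum_range_one, pow_zero, mul_one, he0] at h2
    have hv : Real.log Real.pi / 2 - deriv (Real.log ∘ Real.Gamma) (1 + x / 2) / 2 =
        -(1 / 2) * (deriv (Real.log ∘ Real.Gamma) (1 + x / 2) - d) +
          (Real.log Real.pi / 2 - d / 2) := by ring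
    rw [hv]
    exact h2
  have heq : (fun n => (lehmerB n : ℂ)) = fun n => c n + (e n : ℂ) := by
    refine eq_of_eventually_hasSum_ofReal_pow (f := fun x => zetaLogDeriv x) ?_ ?_
    · filter_upwards [eventually_abs_lt_one] with x hx
      exact hasSum_lehmerB (by rw [norm_real, Real.norm_eq_abs]; linarith)
    · filter_upwards [eventually_abs_lt_one] with x hx
      have h1 := hsum x (by rw [norm_real, Real.norm_eq_abs]; linarith)
      have h2 := hasSum_ofReal.2 (he hx)
      have hx2 : 0 < 1 + x / 2 := by linarith [(abs_lt.1 hx).1]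
      have h3 := digamma_ofReal hx2
      have h4 : zetaLogDeriv x = deriv xiAux x / (1 + xiAux x) + ((Real.log Real.pi / 2 -
          deriv (Real.log ∘ Real.Gamma) (1 + x / 2) / 2 : ℝ) : ℂ) := by
        rw [zetaLogDeriv, show (x : ℂ) / 2 + 1 = ((1 + x / 2 : ℝ) : ℂ) by push_cast; ring, h3]
        push_cast [ofReal_log Real.pi_pos.le]
        ring
      rw [h4]
      refine (h1.add h2).congr_fun fun n => ?_
      push_cast
      ring
  intro n
  have h := congr_arg re (congr_fun heq (n + 1))
  simp only [ofReal_re, add_re, hes] at h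
  rw [h]
  ring

/-! ### The inequality for the Lehmer constants -/

theorem lehmerB_lt (n : ℕ) (hn : 1 ≤ n) :
    lehmerB n < zetaNat (n + 1) - 1 - (1 + (-1 : ℝ) ^ (n + 1)) *
      (zetaNat (n + 1) / 2 ^ (n + 1)) := by
  obtain ⟨m, rfl⟩ := Nat.exists_eq_add_of_le' hn
  obtain ⟨c, hc, hb⟩ := exists_lehmerB_eq
  have h1 := hc (m + 1)
  have h2 := (linear_lt_pow_and_le_pow (k := m + 2) (by omega)).1
  have h3 := one_add_le_zetaNat_mul_one_sub (k := m + 2) (by omega)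
  have h4 := (Complex.abs_re_le_norm (c (m + 1)))
  have h5 : ‖c (m + 1)‖ < 1 / 3 ^ (m + 2) + 1 / 5 ^ (m + 2) := by
    have h6 : (0 : ℝ) < 5 ^ (m + 2) := by positivity
    refine lt_of_mul_lt_mul_right ?_ h6.le
    calc _ ≤ 1.8 * (((m + 1 : ℕ) : ℝ) + 1) := h1
      _ = 1.8 * ((m + 2 : ℕ) : ℝ) := by push_cast; ring
      _ < _ := h2
      _ = _ := by rw [div_pow]; field_simp
  rw [hb m, show m + 1 + 1 = m + 2 from rfl, pow_add (-1 : ℝ) m 2]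
  have h7 := le_abs_self (c (m + 1)).re
  -- The sign-dependent term cancels exactly against the digamma contribution to `lehmerB`, leaving
  -- the sum over odd integers to beat `Re c (m + 1)`.
  have e : zetaNat (m + 2) - 1 - (1 + (-1) ^ m * (-1) ^ 2) * (zetaNat (m + 2) / 2 ^ (m + 2)) =
      zetaNat (m + 2) * (1 - 1 / 2 ^ (m + 2)) - 1 - (-1) ^ m * zetaNat (m + 2) / 2 ^ (m + 2) := by
    ring
  rw [e]
  linarith

theorem mainTheorem11 :
    (∀ s : ℂ, ‖s‖ < 2 → s ≠ 1 →
      HasSum (fun n : ℕ => (lehmerB n : ℂ) * s ^ n)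
        (deriv riemannZeta s / riemannZeta s + 1 / (s - 1))) ∧
    (∀ n : ℕ, 1 ≤ n →
      zetaNat (n + 1) - 1 - (1 + (-1 : ℝ) ^ (n + 1)) * (zetaNat (n + 1) / 2 ^ (n + 1))
        > lehmerB n) ∧
    (∀ n : ℕ, 1 ≤ n →
      lehmerB (2 * n) < zetaNat (2 * n + 1) - 1 ∧ zetaNat (2 * n + 1) - 1 < 1) := by
  refine ⟨fun s hs h1 => ?_, fun n hn => lehmerB_lt n hn, fun n hn => ⟨?_, ?_⟩⟩
  · rw [deriv_riemannZeta_div_add hs h1]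
    exact hasSum_lehmerB hs
  · have h := lehmerB_lt (2 * n) (by omega)
    rw [pow_succ, pow_mul] at h
    simpa using h
  · linarith [zetaNat_lt_two (k := 2 * n + 1) (by omega)]
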